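/- Let $m,n\ge 1$, $0\le\alpha<mn$, $1<p_1,\dots,p_m<\infty$, $\frac1p=\frac1{p_1}+\dots+\frac1{p_m}$ and $0<p\le q<\infty$; write $p'=p/(p-1)$ for $1<p<\infty$. Let $\mathscr B$ be a basis in $\mathbb R^n$, i.e. a collection of nonempty open sets $B\subset\mathbb R^n$ of finite Lebesgue measure $|B|$. Put $$M_{\mathscr B}f(x)=\sup_{B\in\mathscr B,\,B\ni x}\frac1{|B|}\int_B|f|\,dy,\qquad \mathcal M_{\mathscr B,\alpha}(f_1,\dots,f_m)(x)=\sup_{B\in\mathscr B,\,B\ni x}|B|^{\alpha/n}\prod_{i=1}^m\frac1{|B|}\int_B|f_i|\,dy$$ (a supremum over the empty family is $0$). A weight associated with $\mathscr B$ is a measurable function $w:\mathbb R^n\to[0,\infty)$ with $w(B)=\int_B w\,dx<\infty$ for every $B\in\mathscr B$. For $1<s<\infty$, such a weight belongs to $A_{s,\mathscr B}$ if $$\sup_{B\in\mathscr B}\Big(\frac1{|B|}\int_B w\,dx\Big)\Big(\frac1{|B|}\int_B w^{1-s'}dx\Big)^{s/s'}<\infty .$$ (Here and below negative powers of $0$ are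 $\infty$, and $0\cdot\infty=0$.) Assume that $\mathscr B$ is a Muckenhoupt basis: for every $1<s<\infty$ and every $w\in A_{s,\mathscr B}$, $M_{\mathscr B}$ is bounded on $L^s(w)=L^s(\mathbb R^n,w\,dx)$. Let $w_1,\dots,w_m$ and $v$ be weights associated with $\mathscr B$. Suppose that the Tauberian condition $(A_{\mathscr B,\gamma,v})$ holds for some $\gamma\in(0,1)$: there is a constant $c<\infty$ such that $$v\big(\{x\in\mathbb R^n: M_{\mathscr B}(\mathbf 1_E)(x)>\gamma\}\big)\le c\,v(E)\quad\text{for all measurable } E\subset\mathbb R^n,$$ where $v(E)=\int_E v\,dx$; and suppose that the power bump condition $$\sup_{B\in\mathscr B}|B|^{\frac\alpha n+\frac1q-\frac1p}\Big(\frac1{|B|}\int_B v\,dx\Big)^{\frac1q}\prod_{i=1}^m\Big(\frac1{|B|}\int_B w_i^{(1-p_i')r}dx\Big)^{\frac1{rp_i'}}<\infty$$ holds for some $r>1$. Then $\mathcal M_{\mathscr B,\alpha}$ is bounded from $L^{p_1}(w_1)\times\dots\times L^{p_m}(w_m)$ to $L^q(v)$: there is a constant $C<\infty$ such that for all $f_i\in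 L^{p_i}(w_i)$ (Lebesgue measurable functions), $i=1,\dots,m$, $$\|\mathcal M_{\mathscr B,\alpha}(f_1,\dots,f_m)\|_{L^q(v)}\le C\prod_{i=1}^m\|f_i\|_{L^{p_i}(w_i)} .$$ -/

import Mathlib

open MeasureTheory
open scoped NNReal ENNReal

noncomputable section

/-- A basis in `ℝⁿ`: a collection of nonempty open sets of finite Lebesgue measure, so that the
averages `|B|⁻¹ ∫_B` make sense. -/
def IsBasis {n : ℕ} (𝓑 : Set (Set (EuclideanSpace ℝ (Fin n)))) : Prop :=
  ∀ B ∈ 𝓑, IsOpen B ∧ B.Nonempty ∧ volume B < ∞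

/-- The measure `w dx`. -/
def weightMeasure {n : ℕ} (w : EuclideanSpace ℝ (Fin n) → ℝ≥0) :
    Measure (EuclideanSpace ℝ (Fin n)) :=
  volume.withDensity fun x => (w x : ℝ≥0∞)

/-- `w` is a weight associated with `𝓑`: a nonnegative measurable function such that
`w(B) = ∫_B w dx` is finite for each `B ∈ 𝓑`. -/
def IsWeight {n : ℕ} (𝓑 : Set (Set (EuclideanSpace ℝ (Fin n))))
    (w : EuclideanSpace ℝ (Fin n) → ℝ≥0) : Prop :=
  Measurable w ∧ ∀ B ∈ 𝓑, ∫⁻ x in B, (w x : ℝ≥0∞) < ∞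

/-- The norm of `L^p(w)`, that is `(∫ |f|^p w dx)^(1/p)`, for a real exponent `p > 0`. -/
def weightedNorm {n : ℕ} {F : Type*} [ENorm F] (p : ℝ) (w : EuclideanSpace ℝ (Fin n) → ℝ≥0)
    (f : EuclideanSpace ℝ (Fin n) → F) : ℝ≥0∞ :=
  eLpNorm f (ENNReal.ofReal p) (weightMeasure w)

/-- `f ∈ L^p(w)`: `f` is Lebesgue measurable and its `L^p(w)` norm is finite. -/
def MemWeightedLp {n : ℕ} (p : ℝ) (w : EuclideanSpace ℝ (Fin n) → ℝ≥0)
    (f : EuclideanSpace ℝ (Fin n) → ℂ) : Prop :=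
  AEStronglyMeasurable f volume ∧ weightedNorm p w f < ∞

/-- The maximal operator `M_𝓑 f(x) = sup_{B ∋ x, B ∈ 𝓑} |B|⁻¹ ∫_B |f|`
(the supremum over the empty family is `0`). -/
def maximalOp {n : ℕ} (𝓑 : Set (Set (EuclideanSpace ℝ (Fin n))))
    (f : EuclideanSpace ℝ (Fin n) → ℂ) (x : EuclideanSpace ℝ (Fin n)) : ℝ≥0∞ :=
  ⨆ B ∈ 𝓑, ⨆ _ : x ∈ B, ⨍⁻ y in B, ‖f y‖ₑ ∂volume

/-- The multilinear fractional maximal operator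
`𝓜_{𝓑,α}(f₁,…,f_m)(x) = sup_{B ∋ x, B ∈ 𝓑} |B|^(α/n) ∏ᵢ |B|⁻¹ ∫_B |fᵢ|`. -/
def multiFracMaximalOp {n m : ℕ} (𝓑 : Set (Set (EuclideanSpace ℝ (Fin n)))) (α : ℝ)
    (f : Fin m → EuclideanSpace ℝ (Fin n) → ℂ) (x : EuclideanSpace ℝ (Fin n)) : ℝ≥0∞ :=
  ⨆ B ∈ 𝓑, ⨆ _ : x ∈ B, volume B ^ (α / n) * ∏ i, ⨍⁻ y in B, ‖f i y‖ₑ ∂volume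

/-- The class `A_{p,𝓑}`, with `p' = p / (p - 1)`; powers are taken in `[0, ∞]`, so that
`0 ^ (1 - p') = ∞`. -/
def IsApWeight {n : ℕ} (𝓑 : Set (Set (EuclideanSpace ℝ (Fin n)))) (p : ℝ)
    (w : EuclideanSpace ℝ (Fin n) → ℝ≥0) : Prop :=
  IsWeight 𝓑 w ∧
    ⨆ B ∈ 𝓑, (⨍⁻ x in B, (w x : ℝ≥0∞) ∂volume) *
      (⨍⁻ x in B, (w x : ℝ≥0∞) ^ (1 - p.conjExponent) ∂volume) ^ (p / p.conjExponent) < ∞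

/-- `𝓑` is a Muckenhoupt basis: `M_𝓑` is bounded on `L^p(w)` for all `1 < p < ∞` and all
`w ∈ A_{p,𝓑}`. -/
def IsMuckenhouptBasis {n : ℕ} (𝓑 : Set (Set (EuclideanSpace ℝ (Fin n)))) : Prop :=
  IsBasis 𝓑 ∧
    ∀ p : ℝ, 1 < p → ∀ w : EuclideanSpace ℝ (Fin n) → ℝ≥0, IsApWeight 𝓑 p w →
      ∃ C : ℝ≥0, ∀ f : EuclideanSpace ℝ (Fin n) → ℂ, MemWeightedLp p w f →
        weightedNorm p w (maximalOp 𝓑 f) ≤ C * weightedNorm p w f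

/-- The Tauberian condition `(A_{𝓑,γ,μ})` for the weight `μ`: there is a constant `C` with
`μ({M_𝓑(1_E) > γ}) ≤ C μ(E)` for all measurable sets `E`. -/
def TauberianCondition {n : ℕ} (𝓑 : Set (Set (EuclideanSpace ℝ (Fin n)))) (γ : ℝ)
    (μ : EuclideanSpace ℝ (Fin n) → ℝ≥0) : Prop :=
  ∃ C : ℝ≥0, ∀ E : Set (EuclideanSpace ℝ (Fin n)), MeasurableSet E →
    weightMeasure μ {x | ENNReal.ofReal γ < maximalOp 𝓑 (E.indicator fun _ => 1) x} ≤
      C * weightMeasure μ E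

/-- The power bump condition with exponent `r` for the weights `(w₁,…,w_m; v)`. -/
def PowerBumpCondition {n m : ℕ} (𝓑 : Set (Set (EuclideanSpace ℝ (Fin n)))) (α p q r : ℝ)
    (P : Fin m → ℝ) (w : Fin m → EuclideanSpace ℝ (Fin n) → ℝ≥0)
    (v : EuclideanSpace ℝ (Fin n) → ℝ≥0) : Prop :=
  ⨆ B ∈ 𝓑, volume B ^ (α / n + 1 / q - 1 / p) *
    (⨍⁻ x in B, (v x : ℝ≥0∞) ∂volume) ^ (1 / q) *
    ∏ i, (⨍⁻ x in B, (w i x : ℝ≥0∞) ^ ((1 - (P i).conjExponent) * r) ∂volume) ^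
      (1 / (r * (P i).conjExponent)) < ∞

end

open MeasureTheory
open scoped NNReal ENNReal

/-! Let φ(B) be the fractional product of averages over B, let `a i` be conjugate to `r * (P
i).conjExponent`, and put g_i = |f_i|^{a_i} w_i^{a_i/p_i}. Hölder's inequality and the bump
condition give, on a single B, φ(B) v(B)^{1/q} ≤ K |B|^{1/p} ∏ (avg_B g_i)^{1/a_i}
(`average_mul_rpow_weight_le`). Since r > 1, a_i < p_i, so the maximal operator is bounded on the
unweighted L^{p_i/a_i}, where g_i has norm ‖f_i‖_{L^{p_i}(w_i)}^{a_i}.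

To sum over many B, the Tauberian condition plays the part of a covering lemma. Go through a finite
family by decreasing height and discard each set filled beyond the proportion γ by the sets kept so
far. The kept sets have disjoint parts E_B with |E_B| ≥ (1-γ)|B| (`exists_scattered_subfamily`). A
discarded set lies where the maximal function of the union of the kept, at least as high sets
exceeds γ, so discarding costs a factor 1 + c on each level set (`lintegral_sup_rpow_le_sum`).

As q ≥ p, the sum of (q/p)-th powers is at most the power of the sum. On E_B each average is at most
the maximal function of g_i, and Hölder with exponents p_i/p concludes (`sum_scattered_le`).
Lindelöf and monotone convergence pass from finite families to 𝓑. -/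

theorem ENNReal.sum_rpow_le_rpow_sum {ι : Type*} (s : Finset ι) (f : ι → ℝ≥0∞) {p : ℝ}
    (hp : 1 ≤ p) : ∑ i ∈ s, f i ^ p ≤ (∑ i ∈ s, f i) ^ p := by
  classical
  induction s using Finset.induction_on with
  | empty => simp
  | insert a s ha ih =>
    rw [Finset.sum_insert ha, Finset.sum_insert ha]
    exact (add_le_add_right ih _).trans (ENNReal.add_rpow_le_rpow_add _ _ hp)

theorem ENNReal.iSup_rpow_of_pos {ι : Sort*} (f : ι → ℝ≥0∞) {p : ℝ} (hp : 0 < p) :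
    (⨆ i, f i) ^ p = ⨆ i, f i ^ p :=
  (ENNReal.orderIsoRpow p hp).map_iSup f

theorem measurable_finsetSup {X ι : Type*} [MeasurableSpace X] (s : Finset ι) {f : ι → X → ℝ≥0}
    (hf : ∀ i, Measurable (f i)) : Measurable fun x => s.sup fun i => f i x := by
  classical
  induction s using Finset.induction_on with
  | empty => simp
  | insert a s _ ih =>
    simp only [Finset.sup_insert]
    exact (hf a).sup ih

/-! ### Scattered families and the Tauberian condition -/

/-- Greedy selection of a scattered subfamily `T` of a finite family of sets `B i`, `i ∈ S`, in the
order of decreasing `t i`: the selected sets have large disjoint parts, and each rejected set is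
filled up to the proportion `γ` by selected sets that are at least as high. -/
theorem exists_scattered_subfamily {X ι : Type*} [MeasurableSpace X] (μ : Measure X) {γ : ℝ}
    (hγ0 : 0 ≤ γ) {B : ι → Set X} (hB : ∀ i, MeasurableSet (B i))
    (hfin : ∀ i, μ (B i) ≠ ∞) (t : ι → ℝ≥0) (S : Finset ι) :
    ∃ T ⊆ S, ∃ E : ι → Set X,
      (∀ i ∈ T, MeasurableSet (E i) ∧ E i ⊆ B i ∧ ENNReal.ofReal (1 - γ) * μ (B i) ≤ μ (E i)) ∧
      (T : Set ι).PairwiseDisjoint E ∧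
      ∀ i ∈ S, i ∈ T ∨
        ENNReal.ofReal γ * μ (B i) < μ (B i ∩ ⋃ j ∈ {j | j ∈ T ∧ t i ≤ t j}, B j) := by
  classical
  -- The new index `a` has the least height, so every set selected before it counts in its test, and
  -- its arrival cannot spoil earlier tests.
  induction S using Finset.induction_on_min_value t with
  | empty => exact ⟨∅, by simp, fun _ => ∅, by simp⟩
  | insert a S ha hmin ih =>
    obtain ⟨T, hTS, E, hE, hdisj, hS⟩ := ih
    have haT : a ∉ T := fun h => ha (hTS h)
    by_cases hcase : ENNReal.ofReal γ * μ (B a) < μ (B a ∩ ⋃ j ∈ {j | j ∈ T ∧ t a ≤ t j}, B j)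
    · refine ⟨T, hTS.trans (Finset.subset_insert _ _), E, hE, hdisj, fun i hi => ?_⟩
      rcases Finset.mem_insert.1 hi with rfl | hi
      · exact Or.inr hcase
      · exact hS i hi
    · push Not at hcase
      set U : Set X := ⋃ j ∈ {j | j ∈ T ∧ t a ≤ t j}, B j with hU
      have hUm : MeasurableSet U :=
        MeasurableSet.biUnion (T.countable_toSet.mono fun j hj => hj.1) fun j _ => hB j
      have hBU : ∀ j ∈ T, B j ⊆ U := fun j hj =>
        Set.subset_biUnion_of_mem (u := B) (show j ∈ {j | j ∈ T ∧ t a ≤ t j} from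
          ⟨hj, hmin j (hTS hj)⟩)
      have hne : ∀ j ∈ T, j ≠ a := fun j hj h => haT (h ▸ hj)
      refine ⟨insert a T, Finset.insert_subset_insert _ hTS, Function.update E a (B a \ U),
        ?_, ?_, ?_⟩
      · intro i hi
        rcases Finset.mem_insert.1 hi with rfl | hi
        · rw [Function.update_self]
          refine ⟨(hB i).diff hUm, Set.sdiff_subset, ?_⟩
          have h1 : μ (B i \ U) = μ (B i) - μ (B i ∩ U) := by
            rw [← measure_sdiff_add_inter (B i) hUm, ENNReal.add_sub_cancel_right]
            exact ne_top_of_le_ne_top (hfin i) (measure_mono Set.inter_subset_left)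
          rw [h1, ENNReal.ofReal_sub _ hγ0, ENNReal.ofReal_one,
            ENNReal.sub_mul (fun _ _ => hfin i), one_mul]
          exact tsub_le_tsub_left hcase _
        · rw [Function.update_of_ne (hne i hi)]
          exact hE i hi
      · rw [Finset.coe_insert]
        refine Set.PairwiseDisjoint.insert ?_ ?_
        · intro i hi j hj hij
          simp only [Function.onFun, Function.update_of_ne (hne i hi),
            Function.update_of_ne (hne j hj)]
          exact hdisj hi hj hij
        · intro j hj _
          rw [Function.update_self, Function.update_of_ne (hne j hj)]
          exact Set.disjoint_left.2 fun x hx hx' => hx.2 (hBU j hj ((hE j hj).2.1 hx'))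
      · intro i hi
        rcases Finset.mem_insert.1 hi with rfl | hi
        · exact Or.inl (Finset.mem_insert_self _ _)
        · refine (hS i hi).imp (fun h => Finset.mem_insert_of_mem h) fun h => h.trans_le ?_
          refine measure_mono (Set.inter_subset_inter_right _ (Set.biUnion_subset_biUnion_left ?_))
          exact fun j hj => ⟨Finset.mem_insert_of_mem hj.1, hj.2⟩

/-- A good distributional inequality without loss in the level integrates to all powers. -/
theorem lintegral_rpow_le_of_meas_lt_le {X : Type*} [MeasurableSpace X] (ν : Measure X)
    {F G : X → ℝ≥0} (hF : Measurable F) (hG : Measurable G) {C : ℝ≥0}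
    (h : ∀ l : ℝ≥0, ν {x | l < F x} ≤ C * ν {x | l < G x}) {q : ℝ} (hq : 0 < q) :
    ∫⁻ x, (F x : ℝ≥0∞) ^ q ∂ν ≤ C * ∫⁻ x, (G x : ℝ≥0∞) ^ q ∂ν := by
  have key : ∀ {H : X → ℝ≥0}, Measurable H → ∫⁻ x, (H x : ℝ≥0∞) ^ q ∂ν =
      ENNReal.ofReal q * ∫⁻ t in Set.Ioi (0 : ℝ),
        ν {x | t < (H x : ℝ)} * ENNReal.ofReal (t ^ (q - 1)) := by
    intro H hH
    rw [← lintegral_rpow_eq_lintegral_meas_lt_mul ν (Filter.Eventually.of_forall fun x => by simp)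
      hH.coe_nnreal_real.aemeasurable hq]
    refine lintegral_congr fun x => ?_
    rw [← ENNReal.ofReal_rpow_of_nonneg (NNReal.coe_nonneg _) hq.le, ENNReal.ofReal_coe_nnreal]
  rw [key hF, key hG, mul_left_comm, ← lintegral_const_mul' _ _ ENNReal.coe_ne_top]
  refine mul_le_mul' le_rfl ?_
  refine setLIntegral_mono' (measurableSet_Ioi (α := ℝ)) fun t ht => ?_
  rw [← mul_assoc]
  gcongr
  lift t to ℝ≥0 using (le_of_lt ht)
  simpa only [NNReal.coe_lt_coe] using h t

section

variable {n : ℕ} {𝓑 : Set (Set (EuclideanSpace ℝ (Fin n)))}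

/-- A set filled beyond the proportion γ is itself a competitor in the supremum at each of its
points; this links the selection to the Tauberian condition. -/
theorem maximalOp_indicator_gt {γ : ℝ} {E B : Set (EuclideanSpace ℝ (Fin n))}
    (h𝓑 : IsBasis 𝓑) (hE : MeasurableSet E) (hB : B ∈ 𝓑)
    (h : ENNReal.ofReal γ * volume B < volume (B ∩ E)) {x : EuclideanSpace ℝ (Fin n)}
    (hx : x ∈ B) : ENNReal.ofReal γ < maximalOp 𝓑 (E.indicator fun _ => 1) x := by
  obtain ⟨hBo, hBn, hBf⟩ := h𝓑 B hB
  refine lt_of_lt_of_le ?_ (le_iSup₂_of_le B hB (le_iSup_of_le hx le_rfl))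
  have : ∀ y, ‖E.indicator (fun _ => (1 : ℂ)) y‖ₑ = E.indicator 1 y := fun y => by
    by_cases hy : y ∈ E <;> simp [hy]
  simp_rw [this]
  rw [setLAverage_eq, lintegral_indicator_one hE, Measure.restrict_apply hE, Set.inter_comm,
    ENNReal.lt_div_iff_mul_lt (Or.inl (hBo.measure_pos volume hBn).ne') (Or.inl hBf.ne)]
  exact h

/-- Under the Tauberian condition, the maximum of finitely many bumps `t i` on `B i ∈ 𝓑` is
controlled in `L^q(v)` by a scattered subfamily. -/
theorem lintegral_sup_rpow_le_sum (h𝓑 : IsBasis 𝓑) {γ : ℝ} (hγ : 0 ≤ γ)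
    {v : EuclideanSpace ℝ (Fin n) → ℝ≥0} {c : ℝ≥0}
    (hT : ∀ E : Set (EuclideanSpace ℝ (Fin n)), MeasurableSet E →
      weightMeasure v {x | ENNReal.ofReal γ < maximalOp 𝓑 (E.indicator fun _ => 1) x} ≤
        c * weightMeasure v E)
    {ι : Type*} {B : ι → Set (EuclideanSpace ℝ (Fin n))} (hB : ∀ i, B i ∈ 𝓑) (t : ι → ℝ≥0)
    (S : Finset ι) {q : ℝ} (hq : 0 < q) :
    ∃ T ⊆ S, ∃ E : ι → Set (EuclideanSpace ℝ (Fin n)),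
      (∀ i ∈ T, MeasurableSet (E i) ∧ E i ⊆ B i ∧
        ENNReal.ofReal (1 - γ) * volume (B i) ≤ volume (E i)) ∧
      (T : Set ι).PairwiseDisjoint E ∧
      ∫⁻ x, ((S.sup fun i => (B i).indicator (fun _ => t i) x : ℝ≥0) : ℝ≥0∞) ^ q
          ∂weightMeasure v ≤
        (1 + c : ℝ≥0) * ∑ i ∈ T, (t i : ℝ≥0∞) ^ q * weightMeasure v (B i) := by
  have hBm : ∀ i, MeasurableSet (B i) := fun i => (h𝓑 _ (hB i)).1.measurableSet
  obtain ⟨T, hTS, E, hE, hdisj, hS⟩ := exists_scattered_subfamily volume hγ hBm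
    (fun i => (h𝓑 _ (hB i)).2.2.ne) t S
  refine ⟨T, hTS, E, hE, hdisj, ?_⟩
  have hmeas : ∀ R : Finset ι,
      Measurable fun x => R.sup fun i => (B i).indicator (fun _ => t i) x := fun R =>
    measurable_finsetSup R fun i => measurable_const.indicator (hBm i)
  have hlt : ∀ (R : Finset ι) (l : ℝ≥0),
      {x | l < R.sup fun i => (B i).indicator (fun _ => t i) x} =
        ⋃ i ∈ {i | i ∈ R ∧ l < t i}, B i := by
    intro R l
    ext x
    simp only [Set.mem_ofPred_eq, Finset.lt_sup_iff, Set.mem_iUnion, exists_prop, and_assoc]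
    refine exists_congr fun i => and_congr_right fun _ => ?_
    by_cases hx : x ∈ B i <;> simp [hx]
  have hlevel := lintegral_rpow_le_of_meas_lt_le (weightMeasure v) (hmeas S) (hmeas T)
    (C := 1 + c) (q := q) ?_ hq
  · refine hlevel.trans ?_
    gcongr
    calc ∫⁻ x, ((T.sup fun i => (B i).indicator (fun _ => t i) x : ℝ≥0) : ℝ≥0∞) ^ q
          ∂weightMeasure v
        ≤ ∫⁻ x, ∑ i ∈ T, (B i).indicator (fun _ => (t i : ℝ≥0∞) ^ q) x ∂weightMeasure v := by
          refine lintegral_mono fun x => ?_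
          rcases T.eq_empty_or_nonempty with rfl | hTn
          · simp [hq]
          obtain ⟨i, hi, hsup⟩ := T.exists_mem_eq_sup hTn
            fun i => (B i).indicator (fun _ => t i) x
          simp only [hsup]
          refine le_trans ?_ (Finset.single_le_sum
            (f := fun i => (B i).indicator (fun _ => (t i : ℝ≥0∞) ^ q) x)
            (fun _ _ => zero_le) hi)
          by_cases hx : x ∈ B i <;> simp [hx, hq]
      _ = ∑ i ∈ T, (t i : ℝ≥0∞) ^ q * weightMeasure v (B i) := by
          rw [lintegral_finsetSum _ fun i _ => measurable_const.indicator (hBm i)]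
          exact Finset.sum_congr rfl fun i _ => lintegral_indicator_const (hBm i) _
  · intro l
    rw [hlt S, hlt T]
    set G : Set (EuclideanSpace ℝ (Fin n)) := ⋃ i ∈ {i | i ∈ T ∧ l < t i}, B i
    have hGm : MeasurableSet G :=
      MeasurableSet.biUnion (T.countable_toSet.mono fun j hj => hj.1) fun j _ => hBm j
    calc weightMeasure v (⋃ i ∈ {i | i ∈ S ∧ l < t i}, B i)
        ≤ weightMeasure v
          (G ∪ {x | ENNReal.ofReal γ < maximalOp 𝓑 (G.indicator fun _ => 1) x}) := by
          -- A rejected set of height above `l` is filled by selected sets at least as high, all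
          -- contained in `G`; hence the level is not lowered.
          refine measure_mono (Set.iUnion₂_subset fun i hi x hx => ?_)
          rcases hS i hi.1 with hiT | hfill
          · exact Or.inl (Set.mem_biUnion (show i ∈ {i | i ∈ T ∧ l < t i} from ⟨hiT, hi.2⟩) hx)
          · refine Or.inr (maximalOp_indicator_gt h𝓑 hGm (hB i) (hfill.trans_le ?_) hx)
            refine measure_mono (Set.inter_subset_inter_right _
              (Set.biUnion_subset_biUnion_left ?_))
            exact fun j hj => ⟨hj.1, hi.2.trans_le hj.2⟩
      _ ≤ weightMeasure v G + c * weightMeasure v G :=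
          (measure_union_le _ _).trans (add_le_add_right (hT G hGm) _)
      _ = (1 + c : ℝ≥0) * weightMeasure v G := by push_cast; ring

/-! ### Reduction to countably many sets -/

/-- A supremum over an open basis is the supremum of countably many multiples of indicators. -/
theorem exists_countable_iSup_indicator {X : Type*} [TopologicalSpace X]
    [SecondCountableTopology X] {𝓑 : Set (Set X)} (h𝓑 : ∀ B ∈ 𝓑, IsOpen B) (φ : Set X → ℝ≥0∞) :
    ∃ 𝓒 : Set (Set X × ℝ≥0), 𝓒.Countable ∧ (∀ c ∈ 𝓒, c.1 ∈ 𝓑 ∧ (c.2 : ℝ≥0∞) < φ c.1) ∧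
      ∀ x, ⨆ B ∈ 𝓑, ⨆ _ : x ∈ B, φ B =
        ⨆ S : Finset 𝓒, ((S.sup fun c => c.1.1.indicator (fun _ => c.1.2) x : ℝ≥0) : ℝ≥0∞) := by
  -- Lindelöf is applied to each family `φ B > r`. The rational heights stay finite even where `φ B
  -- = ∞`.
  have hcov : ∀ r : ℚ, ∃ 𝓣 ⊆ {B | B ∈ 𝓑 ∧ ((r : ℝ).toNNReal : ℝ≥0∞) < φ B}, 𝓣.Countable ∧
      ⋃ B ∈ 𝓣, B = ⋃ B ∈ {B | B ∈ 𝓑 ∧ ((r : ℝ).toNNReal : ℝ≥0∞) < φ B}, B := fun r =>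
    TopologicalSpace.isOpen_biUnion_countable _ (fun B => B) fun B hB => h𝓑 B hB.1
  choose 𝓣 hsub hcount hUnion using hcov
  refine ⟨⋃ r : ℚ, (fun B => (B, (r : ℝ).toNNReal)) '' 𝓣 r,
    Set.countable_iUnion fun r => (hcount r).image _, ?_, fun x => le_antisymm ?_ ?_⟩
  · intro c hc
    obtain ⟨r, B, hB, rfl⟩ := Set.mem_iUnion.1 hc
    exact hsub r hB
  · refine iSup₂_le fun B hB => iSup_le fun hx => le_of_forall_lt fun a ha => ?_
    obtain ⟨r, -, har, hrφ⟩ := ENNReal.lt_iff_exists_rat_btwn.1 ha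
    have hxU : x ∈ ⋃ B ∈ 𝓣 r, B := by
      rw [hUnion r]
      exact Set.mem_biUnion (show B ∈ {B | B ∈ 𝓑 ∧ ((r : ℝ).toNNReal : ℝ≥0∞) < φ B} from
        ⟨hB, hrφ⟩) hx
    obtain ⟨B', hB', hxB'⟩ := Set.mem_iUnion₂.1 hxU
    refine har.trans_le (le_iSup_of_le
      {⟨(B', (r : ℝ).toNNReal), Set.mem_iUnion.2 ⟨r, B', hB', rfl⟩⟩} ?_)
    simp [hxB']
  · refine iSup_le fun S => ?_
    rcases S.eq_empty_or_nonempty with rfl | hS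
    · simp
    obtain ⟨⟨c, hc⟩, -, hsup⟩ := S.exists_mem_eq_sup hS
      fun c => c.1.1.indicator (fun _ => c.1.2) x
    rw [hsup]
    obtain ⟨r, B, hB, rfl⟩ := Set.mem_iUnion.1 hc
    by_cases hx : x ∈ B
    · simp only [Set.indicator_of_mem hx]
      exact le_iSup₂_of_le B (hsub r hB).1 (le_iSup_of_le hx (hsub r hB).2.le)
    · simp [Set.indicator_of_notMem hx]

end

/-! ### Weighted Hölder inequality and the bump condition -/

/-- Hölder's inequality after inserting `w ^ (1 / p) * w ^ (-1 / p)`. -/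
theorem lintegral_le_rpow_mul_rpow_weight {X : Type*} [MeasurableSpace X] {μ : Measure X}
    {u : X → ℝ≥0∞} (hu : AEMeasurable u μ) {w : X → ℝ≥0} (hw : Measurable w)
    (hw0 : ∀ᵐ x ∂μ, w x ≠ 0) (p : ℝ) {a b : ℝ} (hab : a.HolderConjugate b) :
    ∫⁻ x, u x ∂μ ≤ (∫⁻ x, u x ^ a * (w x : ℝ≥0∞) ^ (a / p) ∂μ) ^ (1 / a) *
      (∫⁻ x, (w x : ℝ≥0∞) ^ (-(b / p)) ∂μ) ^ (1 / b) := by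
  have h := ENNReal.lintegral_mul_le_Lp_mul_Lq μ hab
    (f := fun x => u x * (w x : ℝ≥0∞) ^ (1 / p)) (g := fun x => (w x : ℝ≥0∞) ^ (-(1 / p)))
    (hu.mul (hw.coe_nnreal_ennreal.pow_const _).aemeasurable)
    (hw.coe_nnreal_ennreal.pow_const _).aemeasurable
  refine (lintegral_mono_ae ?_).trans (h.trans_eq ?_)
  · filter_upwards [hw0] with x hx
    rw [Pi.mul_apply, mul_assoc, ← ENNReal.rpow_add _ _ (by simpa using hx) ENNReal.coe_ne_top]
    simp
  · congr 2
    · refine lintegral_congr fun x => ?_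
      rw [ENNReal.mul_rpow_of_nonneg _ _ hab.nonneg, ← ENNReal.rpow_mul, one_div_mul_eq_div]
    · refine lintegral_congr fun x => ?_
      rw [← ENNReal.rpow_mul, neg_mul, one_div_mul_eq_div]

section

variable {n : ℕ} {𝓑 : Set (Set (EuclideanSpace ℝ (Fin n)))}

/-- The function `|f| ^ a * w ^ b`. -/
noncomputable def weightedPow (a b : ℝ) (f : EuclideanSpace ℝ (Fin n) → ℂ)
    (w : EuclideanSpace ℝ (Fin n) → ℝ≥0) (y : EuclideanSpace ℝ (Fin n)) : ℂ :=
  ((‖f y‖₊ ^ a * w y ^ b : ℝ≥0) : ℝ)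

theorem enorm_weightedPow {a b : ℝ} (ha : 0 ≤ a) (hb : 0 ≤ b)
    (f : EuclideanSpace ℝ (Fin n) → ℂ) (w : EuclideanSpace ℝ (Fin n) → ℝ≥0)
    (y : EuclideanSpace ℝ (Fin n)) :
    ‖weightedPow a b f w y‖ₑ = ‖f y‖ₑ ^ a * (w y : ℝ≥0∞) ^ b := by
  rw [weightedPow, enorm_eq_nnnorm, Complex.nnnorm_real, Real.nnnorm_of_nonneg NNReal.zero_le_coe,
    enorm_eq_nnnorm, ← ENNReal.coe_rpow_of_nonneg _ ha, ← ENNReal.coe_rpow_of_nonneg _ hb,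
    ← ENNReal.coe_mul]
  rfl

theorem aestronglyMeasurable_weightedPow {f : EuclideanSpace ℝ (Fin n) → ℂ}
    (hf : AEStronglyMeasurable f volume) {w : EuclideanSpace ℝ (Fin n) → ℝ≥0} (hw : Measurable w)
    (a b : ℝ) : AEStronglyMeasurable (weightedPow a b f w) volume := by
  have h : AEMeasurable (fun y => ‖f y‖₊ ^ a * w y ^ b) volume :=
    (hf.aemeasurable.nnnorm.pow_const a).mul (hw.pow_const b).aemeasurable
  exact (Complex.measurable_ofReal.comp_aemeasurable h.coe_nnreal_real).aestronglyMeasurable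

theorem weightedNorm_rpow {F : Type*} [ENorm F] {p : ℝ} (hp : 0 < p)
    (w : EuclideanSpace ℝ (Fin n) → ℝ≥0) (f : EuclideanSpace ℝ (Fin n) → F) :
    weightedNorm p w f ^ p = ∫⁻ x, ‖f x‖ₑ ^ p ∂weightMeasure w := by
  rw [weightedNorm, eLpNorm_eq_lintegral_rpow_enorm_toReal (by simpa using hp)
    ENNReal.ofReal_ne_top, ENNReal.toReal_ofReal hp.le, ← ENNReal.rpow_mul,
    one_div_mul_cancel hp.ne', ENNReal.rpow_one]

theorem lintegral_weightMeasure {w : EuclideanSpace ℝ (Fin n) → ℝ≥0} (hw : Measurable w)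
    (g : EuclideanSpace ℝ (Fin n) → ℝ≥0∞) :
    ∫⁻ x, g x ∂weightMeasure w = ∫⁻ x, w x * g x := by
  rw [weightMeasure, lintegral_withDensity_eq_lintegral_mul_non_measurable _
    hw.coe_nnreal_ennreal (by simp)]
  rfl

theorem weightMeasure_one : weightMeasure (fun _ : EuclideanSpace ℝ (Fin n) => 1) = volume := by
  rw [weightMeasure]
  exact withDensity_one

theorem lintegral_enorm_weightedPow_rpow {a p : ℝ} (ha : 0 < a) (hp : 0 < p)
    {w : EuclideanSpace ℝ (Fin n) → ℝ≥0} (hw : Measurable w)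
    (f : EuclideanSpace ℝ (Fin n) → ℂ) :
    ∫⁻ x, ‖weightedPow a (a / p) f w x‖ₑ ^ (p / a) = weightedNorm p w f ^ p := by
  rw [weightedNorm_rpow hp, lintegral_weightMeasure hw]
  refine lintegral_congr fun x => ?_
  rw [enorm_weightedPow ha.le (by positivity), ENNReal.mul_rpow_of_nonneg _ _ (by positivity),
    ← ENNReal.rpow_mul, ← ENNReal.rpow_mul, mul_div_cancel₀ _ ha.ne',
    div_mul_div_cancel₀ hp.ne', div_self ha.ne', ENNReal.rpow_one, mul_comm]

theorem IsBasis.laverage_const (h𝓑 : IsBasis 𝓑) {B : Set (EuclideanSpace ℝ (Fin n))}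
    (hB : B ∈ 𝓑) (c : ℝ≥0∞) : ⨍⁻ _ in B, c ∂volume = c := by
  obtain ⟨hBo, hBn, hBf⟩ := h𝓑 B hB
  rw [setLAverage_eq, setLIntegral_const,
    ENNReal.mul_div_cancel_right (hBo.measure_pos volume hBn).ne' hBf.ne]

/-- The Muckenhoupt hypothesis enters only through this constant weight. -/
theorem isApWeight_one (h𝓑 : IsBasis 𝓑) (p : ℝ) : IsApWeight 𝓑 p fun _ => 1 := by
  refine ⟨⟨measurable_const, fun B hB => by simpa using (h𝓑 B hB).2.2⟩, ?_⟩
  refine lt_of_le_of_lt (iSup₂_le fun B hB => ?_) ENNReal.one_lt_top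
  simp [h𝓑.laverage_const hB]

theorem measurable_maximalOp (h𝓑 : IsBasis 𝓑) (f : EuclideanSpace ℝ (Fin n) → ℂ) :
    Measurable (maximalOp 𝓑 f) := by
  refine measurable_of_Ioi fun a => IsOpen.measurableSet ?_
  have : maximalOp 𝓑 f ⁻¹' Set.Ioi a =
      ⋃ B ∈ {B | B ∈ 𝓑 ∧ a < ⨍⁻ y in B, ‖f y‖ₑ ∂volume}, B := by
    ext x
    simp only [maximalOp, Set.mem_preimage, Set.mem_Ioi, lt_iSup_iff, Set.mem_iUnion,
      Set.mem_ofPred_eq, exists_prop]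
    tauto
  rw [this]
  exact isOpen_biUnion fun B hB => (h𝓑 B hB.1).1

/-- The maximal operator of a Muckenhoupt basis is bounded on unweighted Lebesgue spaces. -/
theorem exists_lintegral_maximalOp_weightedPow_le (h𝓑 : IsMuckenhouptBasis 𝓑) {a p : ℝ}
    (ha : 0 < a) (hap : a < p) {w : EuclideanSpace ℝ (Fin n) → ℝ≥0} (hw : Measurable w) :
    ∃ C : ℝ≥0, ∀ f : EuclideanSpace ℝ (Fin n) → ℂ, MemWeightedLp p w f →
      ∫⁻ x, maximalOp 𝓑 (weightedPow a (a / p) f w) x ^ (p / a) ≤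
        C * weightedNorm p w f ^ p := by
  have hp : 0 < p := ha.trans hap
  have hpa : 0 < p / a := by positivity
  obtain ⟨C, hC⟩ := h𝓑.2 (p / a) ((one_lt_div ha).2 hap) _ (isApWeight_one h𝓑.1 _)
  refine ⟨C ^ (p / a), fun f hf => ?_⟩
  have hnorm : weightedNorm (p / a) (fun _ => 1) (weightedPow a (a / p) f w) ^ (p / a) =
      weightedNorm p w f ^ p := by
    rw [weightedNorm_rpow hpa, weightMeasure_one, lintegral_enorm_weightedPow_rpow ha hp hw]
  have hmem : MemWeightedLp (p / a) (fun _ => 1) (weightedPow a (a / p) f w) := by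
    refine ⟨aestronglyMeasurable_weightedPow hf.1 hw _ _, lt_top_iff_ne_top.2 fun htop => ?_⟩
    rw [htop, ENNReal.top_rpow_of_pos hpa] at hnorm
    exact (ENNReal.rpow_lt_top_of_nonneg hp.le hf.2.ne).ne hnorm.symm
  have h := ENNReal.rpow_le_rpow (hC _ hmem) hpa.le
  rw [ENNReal.mul_rpow_of_nonneg _ _ hpa.le, hnorm, weightedNorm_rpow hpa, weightMeasure_one,
    ← ENNReal.coe_rpow_of_nonneg _ hpa.le] at h
  simpa only [enorm_eq_self] using h

/-- The bump condition turns the value of the fractional average on a single set into a product of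
power averages. -/
theorem average_mul_rpow_weight_le {m : ℕ} (h𝓑 : IsBasis 𝓑) {α p q r : ℝ} {P : Fin m → ℝ}
    (hP : ∀ i, 1 < P i) (hq : 0 < q) (hr : 1 < r)
    {w : Fin m → EuclideanSpace ℝ (Fin n) → ℝ≥0} {v : EuclideanSpace ℝ (Fin n) → ℝ≥0}
    (hw : ∀ i, Measurable (w i)) {a : Fin m → ℝ}
    (ha : ∀ i, (a i).HolderConjugate (r * (P i).conjExponent)) {K : ℝ≥0∞} (hK : K ≠ ∞)
    {B : Set (EuclideanSpace ℝ (Fin n))} (hB : B ∈ 𝓑)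
    (hbump : volume B ^ (α / n + 1 / q - 1 / p) *
      (⨍⁻ x in B, (v x : ℝ≥0∞) ∂volume) ^ (1 / q) *
      ∏ i, (⨍⁻ x in B, (w i x : ℝ≥0∞) ^ ((1 - (P i).conjExponent) * r) ∂volume) ^
        (1 / (r * (P i).conjExponent)) ≤ K)
    {f : Fin m → EuclideanSpace ℝ (Fin n) → ℂ} (hf : ∀ i, AEStronglyMeasurable (f i) volume) :
    (volume B ^ (α / n) * ∏ i, ⨍⁻ y in B, ‖f i y‖ₑ ∂volume) * weightMeasure v B ^ (1 / q) ≤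
      K * (volume B ^ (1 / p) *
        ∏ i, (⨍⁻ y in B, ‖weightedPow (a i) (a i / P i) (f i) (w i) y‖ₑ ∂volume) ^
          (1 / a i)) := by
  obtain ⟨hBo, hBn, hBf⟩ := h𝓑 B hB
  have hB0 : volume B ≠ 0 := (hBo.measure_pos volume hBn).ne'
  have hq' : 0 < 1 / q := by positivity
  set V := ⨍⁻ x in B, (v x : ℝ≥0∞) ∂volume with hV
  set W : Fin m → ℝ≥0∞ := fun i =>
    (⨍⁻ x in B, (w i x : ℝ≥0∞) ^ ((1 - (P i).conjExponent) * r) ∂volume) with hWdef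
  have hvB : weightMeasure v B = volume B * V := by
    rw [weightMeasure, withDensity_apply _ hBo.measurableSet, hV, setLAverage_eq,
      ENNReal.mul_div_cancel hB0 hBf.ne]
  -- If `V = 0`, the convention 0 · ∞ = 0 lets the bump condition hold with some `W i = ∞`, but then
  -- the left side vanishes. Otherwise every `W i` is finite, which forces `w i > 0` a.e. on `B`.
  rcases eq_or_ne V 0 with hV0 | hV0
  · rw [hvB, hV0, mul_zero, ENNReal.zero_rpow_of_pos hq', mul_zero]
    exact zero_le
  have hc1 : ∀ i, 0 < (P i).conjExponent - 1 := fun i =>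
    sub_pos.2 (Real.HolderConjugate.conjExponent (hP i)).symm.lt
  have hmeasW : ∀ i, Measurable fun x => (w i x : ℝ≥0∞) ^ ((1 - (P i).conjExponent) * r) :=
    fun i => (hw i).coe_nnreal_ennreal.pow_const _
  have hneg : ∀ i, (1 - (P i).conjExponent) * r < 0 := fun i =>
    mul_neg_of_neg_of_pos (by linarith [hc1 i]) (by linarith)
  have hW0 : ∀ i, W i ≠ 0 := by
    intro i hi
    rw [hWdef] at hi
    simp only [setLAverage_eq, ENNReal.div_eq_zero_iff, hBf.ne, or_false] at hi
    rw [lintegral_eq_zero_iff (hmeasW i)] at hi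
    have hfalse : ∀ᵐ x ∂volume.restrict B, False := by
      filter_upwards [hi] with x hx
      rw [Pi.zero_apply, ENNReal.rpow_eq_zero_iff] at hx
      rcases hx with ⟨-, h⟩ | ⟨h, -⟩
      · exact h.not_gt (hneg i)
      · exact ENNReal.coe_ne_top h
    rw [Filter.eventually_false_iff_eq_bot, ae_eq_bot, Measure.restrict_eq_zero] at hfalse
    exact hB0 hfalse
  have hbpos : ∀ i, 0 < 1 / (r * (P i).conjExponent) := fun i =>
    one_div_pos.2 (ha i).symm.pos
  have hWtop : ∀ i, W i ≠ ∞ := by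
    intro i hi
    refine hK (top_le_iff.1 (le_trans (le_of_eq ?_) hbump))
    have hprod : ∏ j, W j ^ (1 / (r * (P j).conjExponent)) = ∞ := by
      rw [← Finset.mul_prod_erase _ _ (Finset.mem_univ i), hi, ENNReal.top_rpow_of_pos (hbpos i),
        ENNReal.top_mul]
      exact Finset.prod_ne_zero_iff.2 fun j _ h =>
        hW0 j ((ENNReal.rpow_eq_zero_iff_of_pos (hbpos j)).1 h)
    rw [hprod, ENNReal.mul_top]
    exact mul_ne_zero (fun h => by
      rcases ENNReal.rpow_eq_zero_iff.1 h with h | h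
      exacts [hB0 h.1, hBf.ne h.1]) fun h => hV0 ((ENNReal.rpow_eq_zero_iff_of_pos hq').1 h)
  have hw0 : ∀ i, ∀ᵐ x ∂volume.restrict B, w i x ≠ 0 := by
    intro i
    have hfin : ∫⁻ x in B, (w i x : ℝ≥0∞) ^ ((1 - (P i).conjExponent) * r) ≠ ∞ := fun h =>
      hWtop i (by simp only [hWdef, setLAverage_eq, h, ENNReal.top_div_of_ne_top hBf.ne])
    filter_upwards [ae_lt_top (hmeasW i) hfin] with x hx h
    rw [h, ENNReal.coe_zero, ENNReal.zero_rpow_of_neg (hneg i)] at hx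
    exact lt_irrefl _ hx
  have hHolder : ∀ i, ⨍⁻ y in B, ‖f i y‖ₑ ∂volume ≤
      (⨍⁻ y in B, ‖weightedPow (a i) (a i / P i) (f i) (w i) y‖ₑ ∂volume) ^ (1 / a i) *
        W i ^ (1 / (r * (P i).conjExponent)) := by
    intro i
    have hPi : 0 < P i := by linarith [hP i]
    have hexp : (1 - (P i).conjExponent) * r = -(r * (P i).conjExponent / P i) := by
      have : P i - 1 ≠ 0 := by linarith [hP i]
      rw [Real.conjExponent]
      field_simp
      ring
    simp only [hWdef, hexp, enorm_weightedPow (ha i).nonneg (div_nonneg (ha i).nonneg hPi.le)]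
    -- Hölder is applied to the normalised measure on `B`, so no power of |B| appears.
    refine lintegral_le_rpow_mul_rpow_weight ?_ (hw i) ?_ (P i) (ha i)
    · exact ((hf i).enorm.restrict).smul_measure _
    · exact Measure.ae_smul_measure (hw0 i) _
  calc (volume B ^ (α / n) * ∏ i, ⨍⁻ y in B, ‖f i y‖ₑ ∂volume) * weightMeasure v B ^ (1 / q)
      ≤ (volume B ^ (α / n) *
          ∏ i, ((⨍⁻ y in B, ‖weightedPow (a i) (a i / P i) (f i) (w i) y‖ₑ ∂volume) ^ (1 / a i) *
          W i ^ (1 / (r * (P i).conjExponent)))) * weightMeasure v B ^ (1 / q) := by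
        gcongr with i
        exact hHolder i
    _ = (volume B ^ (α / n + 1 / q - 1 / p) * V ^ (1 / q) *
          ∏ i, W i ^ (1 / (r * (P i).conjExponent))) * (volume B ^ (1 / p) *
          ∏ i, (⨍⁻ y in B, ‖weightedPow (a i) (a i / P i) (f i) (w i) y‖ₑ ∂volume) ^
            (1 / a i)) := by
        have h1 : volume B ^ (α / n) * volume B ^ (1 / q) =
            volume B ^ (α / n + 1 / q - 1 / p) * volume B ^ (1 / p) := by
          rw [← ENNReal.rpow_add _ _ hB0 hBf.ne, ← ENNReal.rpow_add _ _ hB0 hBf.ne]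
          congr 1
          ring
        rw [hvB, ENNReal.mul_rpow_of_nonneg _ _ hq'.le, Finset.prod_mul_distrib]
        calc _ = (volume B ^ (α / n) * volume B ^ (1 / q)) * V ^ (1 / q) *
              (∏ i, W i ^ (1 / (r * (P i).conjExponent))) *
              ∏ i, (⨍⁻ y in B, ‖weightedPow (a i) (a i / P i) (f i) (w i) y‖ₑ ∂volume) ^
                (1 / a i) := by ring
          _ = _ := by rw [h1]; ring
    _ ≤ _ := by gcongr

end

/-! ### Summation over a scattered family -/

section

variable {n : ℕ} {𝓑 : Set (Set (EuclideanSpace ℝ (Fin n)))}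

/-- Products of power averages over a scattered family are summable, with a bound by the maximal
functions. -/
theorem sum_scattered_le (h𝓑 : IsBasis 𝓑) {m : ℕ} {p : ℝ} {P : Fin m → ℝ} (hp : 0 < p)
    (hP : ∀ i, 0 < P i) (hpP : 1 / p = ∑ i, 1 / P i) {a : Fin m → ℝ} (ha : ∀ i, 0 < a i)
    (g : Fin m → EuclideanSpace ℝ (Fin n) → ℂ) {δ : ℝ≥0∞} (hδ0 : δ ≠ 0) (hδ : δ ≠ ∞) {ι : Type*}
    {B E : ι → Set (EuclideanSpace ℝ (Fin n))} (hB : ∀ i, B i ∈ 𝓑) {T : Finset ι}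
    (hE : ∀ i ∈ T, MeasurableSet (E i) ∧ E i ⊆ B i ∧ δ * volume (B i) ≤ volume (E i))
    (hdisj : (T : Set ι).PairwiseDisjoint E) :
    ∑ i ∈ T, volume (B i) * ∏ j, (⨍⁻ y in B i, ‖g j y‖ₑ ∂volume) ^ (p / a j) ≤
      δ⁻¹ * ∏ j, (∫⁻ x, maximalOp 𝓑 (g j) x ^ (P j / a j)) ^ (p / P j) := by
  have hM : ∀ j, Measurable (maximalOp 𝓑 (g j)) := fun j => measurable_maximalOp h𝓑 _
  calc ∑ i ∈ T, volume (B i) * ∏ j, (⨍⁻ y in B i, ‖g j y‖ₑ ∂volume) ^ (p / a j)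
      ≤ ∑ i ∈ T, δ⁻¹ * ∫⁻ x in E i, ∏ j, maximalOp 𝓑 (g j) x ^ (p / a j) := by
        refine Finset.sum_le_sum fun i hi => ?_
        obtain ⟨hEm, hEB, hEδ⟩ := hE i hi
        have hvol : volume (B i) ≤ δ⁻¹ * volume (E i) := by
          rwa [← ENNReal.div_eq_inv_mul, ENNReal.le_div_iff_mul_le (Or.inl hδ0) (Or.inl hδ),
            mul_comm]
        calc _ ≤ (δ⁻¹ * volume (E i)) *
              ∏ j, (⨍⁻ y in B i, ‖g j y‖ₑ ∂volume) ^ (p / a j) := by gcongr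
          _ = δ⁻¹ * ∫⁻ x in E i, ∏ j, (⨍⁻ y in B i, ‖g j y‖ₑ ∂volume) ^ (p / a j) := by
            rw [setLIntegral_const]
            ring
          _ ≤ _ := by
            gcongr δ⁻¹ * ?_
            refine setLIntegral_mono' hEm fun x hx => ?_
            gcongr with j
            · exact (div_pos hp (ha j)).le
            · exact le_iSup₂_of_le (B i) (hB i) (le_iSup_of_le (hEB hx) le_rfl)
    _ = δ⁻¹ * ∫⁻ x in ⋃ i ∈ T, E i, ∏ j, maximalOp 𝓑 (g j) x ^ (p / a j) := by
        rw [lintegral_biUnion_finset hdisj fun i hi => (hE i hi).1, Finset.mul_sum]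
    _ ≤ δ⁻¹ * ∫⁻ x, ∏ j, (maximalOp 𝓑 (g j) x ^ (P j / a j)) ^ (p / P j) := by
        gcongr δ⁻¹ * ?_
        refine (setLIntegral_le_lintegral _ _).trans_eq (lintegral_congr fun x => ?_)
        refine Finset.prod_congr rfl fun j _ => ?_
        rw [← ENNReal.rpow_mul, mul_comm (P j / a j), div_mul_div_cancel₀ (hP j).ne']
    _ ≤ _ := by
        gcongr δ⁻¹ * ?_
        -- Hölder for several functions: the exponents `p / P j` add up to 1.
        refine ENNReal.lintegral_prod_norm_pow_le Finset.univ
          (fun j _ => ((hM j).pow_const _).aemeasurable) ?_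
          fun j _ => (div_pos hp (hP j)).le
        simp_rw [div_eq_mul_one_div p, ← Finset.mul_sum]
        rw [← hpP, mul_one_div_cancel hp.ne']

end

/-! ### The strong type bound -/

theorem corollary2p7 (n m : ℕ) (α p q : ℝ) (P : Fin m → ℝ)
    (hα : 0 ≤ α) (hαmn : α < m * n)
    (hP : ∀ i, 1 < P i) (hpP : 1 / p = ∑ i, 1 / P i)
    (hp : 0 < p) (hpq : p ≤ q)
    (𝓑 : Set (Set (EuclideanSpace ℝ (Fin n)))) (h𝓑 : IsMuckenhouptBasis 𝓑)
    (w : Fin m → EuclideanSpace ℝ (Fin n) → ℝ≥0) (v : EuclideanSpace ℝ (Fin n) → ℝ≥0)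
    (hw : ∀ i, IsWeight 𝓑 (w i)) (hv : IsWeight 𝓑 v)
    (hT : ∃ γ : ℝ, 0 < γ ∧ γ < 1 ∧ TauberianCondition 𝓑 γ v)
    (hbump : ∃ r : ℝ, 1 < r ∧ PowerBumpCondition 𝓑 α p q r P w v) :
    ∃ C : ℝ≥0, ∀ f : Fin m → EuclideanSpace ℝ (Fin n) → ℂ,
      (∀ i, MemWeightedLp (P i) (w i) (f i)) →
        weightedNorm q v (multiFracMaximalOp 𝓑 α f) ≤
          C * ∏ i, weightedNorm (P i) (w i) (f i) := by
  obtain ⟨γ, hγ0, hγ1, c, hc⟩ := hT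
  obtain ⟨r, hr, hK⟩ := hbump
  have hq : 0 < q := hp.trans_le hpq
  have hP0 : ∀ i, 0 < P i := fun i => one_pos.trans (hP i)
  have hconj : ∀ i, (P i).HolderConjugate (P i).conjExponent := fun i =>
    Real.HolderConjugate.conjExponent (hP i)
  have hrc : ∀ i, (P i).conjExponent < r * (P i).conjExponent := fun i =>
    lt_mul_of_one_lt_left (hconj i).symm.pos hr
  set a : Fin m → ℝ := fun i => (r * (P i).conjExponent).conjExponent
  have ha : ∀ i, (a i).HolderConjugate (r * (P i).conjExponent) := fun i =>
    (Real.HolderConjugate.conjExponent ((hconj i).symm.lt.trans (hrc i))).symm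
  -- The gain from r > 1: the exponent `P i / a i` exceeds 1, as boundedness of the maximal operator
  -- requires.
  have haP : ∀ i, a i < P i := fun i => by
    have h1 := (ha i).inv_add_inv_eq_one
    have h2 := (hconj i).inv_add_inv_eq_one
    have h3 := inv_strictAnti₀ (hconj i).symm.pos (hrc i)
    exact (inv_lt_inv₀ (hP0 i) (ha i).pos).1 (by linarith)
  choose D hD using fun i =>
    exists_lintegral_maximalOp_weightedPow_le h𝓑 (ha i).pos (haP i) (hw i).1
  unfold PowerBumpCondition at hK
  set K := ⨆ B ∈ 𝓑, volume B ^ (α / n + 1 / q - 1 / p) *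
    (⨍⁻ x in B, (v x : ℝ≥0∞) ∂volume) ^ (1 / q) *
    ∏ i, (⨍⁻ x in B, (w i x : ℝ≥0∞) ^ ((1 - (P i).conjExponent) * r) ∂volume) ^
      (1 / (r * (P i).conjExponent))
  have hpq0 : 0 ≤ q / p := by positivity
  have hδ0 : ENNReal.ofReal (1 - γ) ≠ 0 := by simpa using hγ1
  set A : ℝ≥0∞ := (1 + c : ℝ≥0) * (K ^ p * ((ENNReal.ofReal (1 - γ))⁻¹ *
    ∏ i, (D i : ℝ≥0∞) ^ (p / P i))) ^ (q / p) with hAdef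
  have hA : A ≠ ∞ := by
    refine ENNReal.mul_ne_top ENNReal.coe_ne_top (ENNReal.rpow_ne_top_of_nonneg hpq0 ?_)
    refine ENNReal.mul_ne_top (ENNReal.rpow_ne_top_of_nonneg hp.le hK.ne)
      (ENNReal.mul_ne_top (ENNReal.inv_ne_top.2 hδ0) (ENNReal.prod_ne_top fun i _ => ?_))
    exact ENNReal.rpow_ne_top_of_nonneg (div_pos hp (hP0 i)).le ENNReal.coe_ne_top
  have hmain : ∀ f : Fin m → EuclideanSpace ℝ (Fin n) → ℂ,
      (∀ i, MemWeightedLp (P i) (w i) (f i)) →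
      ∫⁻ x, multiFracMaximalOp 𝓑 α f x ^ q ∂weightMeasure v ≤
        A * (∏ i, weightedNorm (P i) (w i) (f i)) ^ q := by
    intro f hf
    set φ : Set (EuclideanSpace ℝ (Fin n)) → ℝ≥0∞ := fun B =>
      volume B ^ (α / n) * ∏ i, ⨍⁻ y in B, ‖f i y‖ₑ ∂volume
    obtain ⟨𝓒, h𝓒c, h𝓒, hsup⟩ := exists_countable_iSup_indicator
      (fun B hB => (h𝓑.1 B hB).1) φ
    have : Countable 𝓒 := h𝓒c.to_subtype
    set F : Finset 𝓒 → EuclideanSpace ℝ (Fin n) → ℝ≥0∞ := fun S x =>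
      ((S.sup fun c => c.1.1.indicator (fun _ => c.1.2) x : ℝ≥0) : ℝ≥0∞) ^ q
    have hFm : ∀ S, Measurable (F S) := fun S =>
      (measurable_finsetSup S fun c => measurable_const.indicator
        (h𝓑.1 _ (h𝓒 _ c.2).1).1.measurableSet).coe_nnreal_ennreal.pow_const _
    have hFdir : Directed (· ≤ ·) F := by
      refine Monotone.directed_le fun S S' hSS' x => ?_
      exact ENNReal.rpow_le_rpow (ENNReal.coe_le_coe.2 (Finset.sup_mono hSS')) hq.le
    have hFeq : ∀ x, multiFracMaximalOp 𝓑 α f x ^ q = ⨆ S, F S x := fun x => by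
      rw [← ENNReal.iSup_rpow_of_pos _ hq, ← hsup x]
      rfl
    simp_rw [hFeq]
    -- Monotone convergence along finite subfamilies; `𝓒` being countable, there are countably many
    -- of them.
    rw [lintegral_iSup_directed (fun S => (hFm S).aemeasurable) hFdir]
    refine iSup_le fun S => ?_
    obtain ⟨T, -, E, hE, hdisj, hle⟩ := lintegral_sup_rpow_le_sum h𝓑.1 hγ0.le hc
      (B := fun c : 𝓒 => c.1.1) (fun c => (h𝓒 _ c.2).1) (fun c => c.1.2) S hq
    set G : Fin m → Set (EuclideanSpace ℝ (Fin n)) → ℝ≥0∞ := fun i B =>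
      ⨍⁻ y in B, ‖weightedPow (a i) (a i / P i) (f i) (w i) y‖ₑ ∂volume
    have hterm : ∀ d : 𝓒, (d.1.2 : ℝ≥0∞) ^ q * weightMeasure v d.1.1 ≤
        (K ^ p * (volume d.1.1 * ∏ i, G i d.1.1 ^ (p / a i))) ^ (q / p) := by
      intro d
      obtain ⟨hd, hdφ⟩ := h𝓒 _ d.2
      have h := average_mul_rpow_weight_le h𝓑.1 (α := α) (p := p) hP hq hr
        (fun i => (hw i).1) ha hK.ne hd
        (le_iSup₂ (f := fun (B : Set (EuclideanSpace ℝ (Fin n))) (_ : B ∈ 𝓑) =>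
          volume B ^ (α / n + 1 / q - 1 / p) * (⨍⁻ x in B, (v x : ℝ≥0∞) ∂volume) ^ (1 / q) *
          ∏ i, (⨍⁻ x in B, (w i x : ℝ≥0∞) ^ ((1 - (P i).conjExponent) * r) ∂volume) ^
            (1 / (r * (P i).conjExponent))) d.1.1 hd) fun i => (hf i).1
      calc (d.1.2 : ℝ≥0∞) ^ q * weightMeasure v d.1.1
          ≤ φ d.1.1 ^ q * weightMeasure v d.1.1 := by gcongr
        _ = (φ d.1.1 * weightMeasure v d.1.1 ^ (1 / q)) ^ q := by
            rw [ENNReal.mul_rpow_of_nonneg (φ d.1.1) _ hq.le,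
              ← ENNReal.rpow_mul (weightMeasure v d.1.1), one_div_mul_cancel hq.ne', ENNReal.rpow_one]
        _ ≤ (K * (volume d.1.1 ^ (1 / p) * ∏ i, G i d.1.1 ^ (1 / a i))) ^ q :=
            ENNReal.rpow_le_rpow h hq.le
        _ = ((K * (volume d.1.1 ^ (1 / p) * ∏ i, G i d.1.1 ^ (1 / a i))) ^ p) ^ (q / p) := by
            rw [← ENNReal.rpow_mul, mul_div_cancel₀ _ hp.ne']
        _ = _ := by
            rw [ENNReal.mul_rpow_of_nonneg _ _ hp.le, ENNReal.mul_rpow_of_nonneg _ _ hp.le,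
              ← ENNReal.rpow_mul, one_div_mul_cancel hp.ne', ENNReal.rpow_one,
              ← ENNReal.prod_rpow_of_nonneg hp.le]
            simp_rw [← ENNReal.rpow_mul, one_div_mul_eq_div]
    calc ∫⁻ x, F S x ∂weightMeasure v
        ≤ (1 + c : ℝ≥0) * ∑ d ∈ T, (d.1.2 : ℝ≥0∞) ^ q * weightMeasure v d.1.1 := hle
      _ ≤ (1 + c : ℝ≥0) *
          ∑ d ∈ T, (K ^ p * (volume d.1.1 * ∏ i, G i d.1.1 ^ (p / a i))) ^ (q / p) := by
          gcongr with d
          exact hterm d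
      _ ≤ (1 + c : ℝ≥0) *
          (K ^ p * ∑ d ∈ T, volume d.1.1 * ∏ i, G i d.1.1 ^ (p / a i)) ^ (q / p) := by
          rw [Finset.mul_sum _ _ (K ^ p)]
          gcongr
          -- This is where p ≤ q is needed: q/p ≥ 1.
          exact ENNReal.sum_rpow_le_rpow_sum _ _ ((one_le_div hp).2 hpq)
      _ ≤ (1 + c : ℝ≥0) * (K ^ p * ((ENNReal.ofReal (1 - γ))⁻¹ *
          ∏ i, (D i * weightedNorm (P i) (w i) (f i) ^ P i) ^ (p / P i))) ^ (q / p) := by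
          gcongr
          refine (sum_scattered_le h𝓑.1 hp hP0 hpP (fun i => (ha i).pos) _ hδ0
            ENNReal.ofReal_ne_top (fun c : 𝓒 => (h𝓒 _ c.2).1) hE hdisj).trans ?_
          gcongr with i
          · exact (div_pos hp (hP0 i)).le
          · exact hD i (f i) (hf i)
      _ = A * (∏ i, weightedNorm (P i) (w i) (f i)) ^ q := by
          have hprod : ∏ i, ((D i : ℝ≥0∞) * weightedNorm (P i) (w i) (f i) ^ P i) ^ (p / P i) =
              (∏ i, (D i : ℝ≥0∞) ^ (p / P i)) * (∏ i, weightedNorm (P i) (w i) (f i)) ^ p := by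
            rw [← ENNReal.prod_rpow_of_nonneg hp.le, ← Finset.prod_mul_distrib]
            refine Finset.prod_congr rfl fun i _ => ?_
            rw [ENNReal.mul_rpow_of_nonneg _ _ (div_pos hp (hP0 i)).le, ← ENNReal.rpow_mul,
              mul_div_cancel₀ _ (hP0 i).ne']
          rw [hprod, ← mul_assoc, ← mul_assoc, ENNReal.mul_rpow_of_nonneg _ _ hpq0,
            ← ENNReal.rpow_mul, mul_div_cancel₀ _ hp.ne', hAdef, mul_assoc (K ^ p), mul_assoc]
  refine ⟨(A ^ (1 / q)).toNNReal, fun f hf => ?_⟩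
  have hq' : 0 ≤ 1 / q := by positivity
  rw [ENNReal.coe_toNNReal (ENNReal.rpow_ne_top_of_nonneg hq' hA)]
  have h := ENNReal.rpow_le_rpow (hmain f hf) hq'
  rw [ENNReal.mul_rpow_of_nonneg _ _ hq', ← ENNReal.rpow_mul, mul_one_div_cancel hq.ne',
    ENNReal.rpow_one] at h
  refine le_trans (le_of_eq ?_) h
  rw [weightedNorm, eLpNorm_eq_lintegral_rpow_enorm_toReal (by simpa using hq)
    ENNReal.ofReal_ne_top, ENNReal.toReal_ofReal hq.le]
  simp only [enorm_eq_self]
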